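/- **Notation.** Let $\Delta(\tau)=q\prod_{n\ge1}(1-q^n)^{24}$ ($q=e^{2\pi i\tau}$) be the modular discriminant on the upper half-plane $\mathbb H$, $c_4=E_4=1+240q+\cdots$, $j=c_4^3/\Delta$, and $g_\infty(\tau)=-\log\big((4\pi\,\mathrm{Im}\,\tau)^6|\Delta(\tau)|\big)$. *Faltings' height.* For an elliptic curve $E$ over a number field $K$ with minimal discriminant $\Delta_{E/K}$, put $$h_F(E/K)=\frac1{12[K:\mathbb Q]}\Big(\log|N_{K/\mathbb Q}(\Delta_{E/K})|+\sum_{\sigma:K\to\mathbb C}g_\infty(\tau_\sigma)\Big),$$ where $\tau_\sigma\in\mathbb H$ is such that $E_\sigma(\mathbb C)\cong\mathbb C/(\mathbb Z+\tau_\sigma\mathbb Z)$. For $\alpha\in\overline{\mathbb Q}$ put $h_F(\alpha)=h_F(E/L)$, where $L$ is a number field containing $\alpha$ and $E/L$ is a semistable elliptic curve with $j(E)=\alpha$. The essential minimum is $\mu_F^{\rm ess}=\inf\{\theta\in\mathbb R:\{\alpha\in\overline{\mathbb Q}:h_F(\alpha)\le\theta\}\text{ is infinite}\}$. *The metrized line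 bundle.* On $\mathcal X=\mathbb P^1_{\mathbb Z}$ with homogeneous coordinates $[\zeta_0:\zeta_1]$ let $\mathcal L=\mathcal O(D_\infty)$, $\infty=[1:0]$; the global sections of $\mathcal L^{\otimes n}$ are the homogeneous forms of degree $n$ in $\mathbb Z[\zeta_0,\zeta_1]$. Identify $\mathrm{SL}_2(\mathbb Z)\backslash\mathbb H\cup\{\infty\}$ with $\mathcal X(\mathbb C)$ by $\tau\mapsto[c_4(\tau)^3:\Delta(\tau)]$, and a section $P$ of $\mathcal L^{\otimes n}$ with the modular form $P(c_4^3,\Delta)$ of weight $12n$; its Petersson norm at the image of $\tau$ is $\|P\|_{\rm Pet}=(4\pi\,\mathrm{Im}\,\tau)^{6n}|P(c_4(\tau)^3,\Delta(\tau))|$, and at $\infty$ it is the limit of this for $\mathrm{Im}\,\tau\to\infty$, in $[0,\infty]$. At a finite place $v$ the norm is $\|P(\zeta)\|_v=|P(\zeta_0,\zeta_1)|_v/\max(|\zeta_0|_v,|\zeta_1|_v)^n$. For $x\in\overline{\mathbb Q}$, seen as the point $[x:1]$, a number field $K\ni x$ and a section $P$ of $\mathcal L$ with $P(x)\neq0$,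 the height is $$h_{\overline{\mathcal L}}(x)=\frac1{[K:\mathbb Q]}\Big(\sum_{v\nmid\infty}-\log\|P(x)\|_v+\sum_{\sigma:K\to\mathbb C}-\log\|P(\sigma(x))\|_{\rm Pet}\Big),$$ with $|\cdot|_v$ normalized so that the product formula holds; it does not depend on $K$ and $P$. *Real sections.* A real global section is a formal product $s=s_1^{\otimes a_1}\otimes\cdots\otimes s_\ell^{\otimes a_\ell}$ with real $a_k>0$ and nonzero $s_k\in\Gamma(\mathcal X,\mathcal L^{\otimes n_k})$. Its weight is $12(a_1n_1+\cdots+a_\ell n_\ell)$ (so that $\Delta$ has weight $12$ and $\Delta^{1/12}$ has weight one), $|\mathrm{div}(s)|\subset\mathcal X(\overline{\mathbb Q})$ is the union of the zero sets of the $s_k$, $\|s\|_{\rm Pet}=\prod_k\|s_k\|_{\rm Pet}^{a_k}$ (with $0\cdot\infty=0$ at the point $\infty$), and $g_s=-\log\|s\|_{\rm Pet}:\mathcal X(\mathbb C)\to[-\infty,\infty]$. **Proposition.** Let $s$ be a real global section of weight one. For every $x\in\overline{\mathbb Q}$ with $x\notin|\mathrm{div}(s)|$, $$h_F(x)=\tfrac1{12}h_{\overline{\mathcal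 L}}(x)\ \ge\ \inf_{y\in\mathcal X(\mathbb C)}g_s(y)=-\log\sup_{y\in\mathcal X(\mathbb C)}\|s(y)\|_{\rm Pet}.$$ In particular $\mu_F^{\rm ess}\ge\inf_{y\in\mathcal X(\mathbb C)}g_s(y)$. -/

import Mathlib

open NumberField IsDedekindDomain UpperHalfPlane
open scoped ENNReal

noncomputable section

namespace FaltingsEssMin

/-- The field of algebraic numbers. -/
abbrev Qbar : Type := AlgebraicClosure ℚ

instance : Algebra.IsAlgebraic ℚ Qbar := AlgebraicClosure.isAlgebraic ℚ

/-! ### Modular functions of level one -/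

/-- The `j`-invariant `j = c₄³ / Δ = 1/q + 744 + ⋯`, where `c₄ = E₄ = 1 + 240 q + ⋯` and
`Δ = q ∏ (1 - qⁿ)²⁴`. -/
def jInv (τ : ℍ) : ℂ := (ModularForm.E₄ τ) ^ 3 / ModularForm.discriminant τ

/-- The hyperbolic Green function `g_∞(τ) = - log ((4π Im τ)⁶ |Δ(τ)|)`. -/
def gInf (τ : ℍ) : ℝ :=
  -Real.log ((4 * Real.pi * τ.im) ^ 6 * ‖ModularForm.discriminant τ‖)

/-! ### Elliptic curves over the complex numbers -/

theorem indep_one_tau (τ : ℍ) : LinearIndependent ℝ ![(1 : ℂ), (τ : ℂ)] := by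
  rw [LinearIndependent.pair_iff]
  intro a b h
  have him : (a • (1 : ℂ) + b • (τ : ℂ)).im = 0 := by rw [h]; simp
  have hb : b = 0 := by
    have h2 : b * τ.im = 0 := by simpa using him
    exact (mul_eq_zero.mp h2).resolve_right τ.im_pos.ne'
  subst hb
  have hre : (a • (1 : ℂ) + (0 : ℝ) • (τ : ℂ)).re = 0 := by rw [h]; simp
  exact ⟨by simpa using hre, rfl⟩

/-- The pair of periods `1, τ`, spanning the lattice `ℤ + τ ℤ`. -/
def periodPair (τ : ℍ) : PeriodPair := ⟨1, (τ : ℂ), indep_one_tau τ⟩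

/-- The elliptic curve `ℂ / (ℤ + τ ℤ)` in its Weierstrass form
`Y² = X³ - (g₂/4) X - g₃/4`, with `X = ℘(z)` and `Y = ℘'(z)/2`. -/
def torusCurve (τ : ℍ) : WeierstrassCurve ℂ :=
  ⟨0, 0, 0, -(periodPair τ).g₂ / 4, -(periodPair τ).g₃ / 4⟩

/-- The map `z ↦ (℘(z), ℘'(z)/2)` sends `ℂ / (ℤ + τ ℤ)`, minus the origin, to the curve. -/
theorem torusCurve_equation (τ : ℍ) (z : ℂ) (hz : z ∉ (periodPair τ).lattice) :
    (torusCurve τ).toAffine.Equation ((periodPair τ).weierstrassP z)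
      ((periodPair τ).derivWeierstrassP z / 2) := by
  have h := (periodPair τ).derivWeierstrassP_sq z hz
  rw [WeierstrassCurve.Affine.equation_iff]
  simp only [torusCurve]
  linear_combination h / 4

/-- `E(ℂ) ≅ ℂ / (ℤ + τ ℤ)`. -/
def IsUniformizedBy (E : WeierstrassCurve ℂ) (τ : ℍ) : Prop :=
  ∃ C : WeierstrassCurve.VariableChange ℂ, C • E = torusCurve τ

/-- A chosen `τ` in the upper half plane with `E(ℂ) ≅ ℂ / (ℤ + τ ℤ)`. -/
def periodPoint (E : WeierstrassCurve ℂ) : ℍ :=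
  Classical.epsilon fun τ => IsUniformizedBy E τ

/-! ### Faltings' height of an elliptic curve over a number field -/

section NumberFields

variable {K : Type*} [Field K] [NumberField K]

/-- The discrete valuation ring of `v`-integral elements of the number field `K`. -/
abbrev localRing (v : HeightOneSpectrum (𝓞 K)) : ValuationSubring K :=
  (v.valuation K).valuationSubring

instance (v : HeightOneSpectrum (𝓞 K)) : IsDiscreteValuationRing (localRing v) :=
  (v.valuation K).valuationSubring_isDiscreteValuationRing

/-- The exponent at `v` of the minimal discriminant: the order at `v` of the discriminant of a
Weierstrass equation of `E` that is minimal at `v`. -/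
def minDiscExponent (E : WeierstrassCurve K) (v : HeightOneSpectrum (𝓞 K)) : ℕ :=
  (-WithZero.log (v.valuation K (E.minimal (localRing v)).Δ)).toNat

/-- The minimal discriminant `Δ_{E/K}`, an ideal of the ring of integers. -/
def minimalDiscriminant (E : WeierstrassCurve K) : Ideal (𝓞 K) :=
  ∏ᶠ v : HeightOneSpectrum (𝓞 K), v.asIdeal ^ minDiscExponent E v

/-- `E/K` is semistable: at every finite place it has good or multiplicative reduction. -/
def IsSemistable (E : WeierstrassCurve K) : Prop :=
  ∀ v : HeightOneSpectrum (𝓞 K),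
    (E.minimal (localRing v)).HasGoodReduction (localRing v) ∨
      (E.minimal (localRing v)).HasMultiplicativeReduction (localRing v)

/-- Faltings' height `h_F(E/K)`. -/
def faltingsHeightCurve (E : WeierstrassCurve K) : ℝ :=
  1 / (12 * (Module.finrank ℚ K : ℝ)) *
    (Real.log (Ideal.absNorm (minimalDiscriminant E) : ℝ) +
      ∑ σ : K →+* ℂ, gInf (periodPoint (E.map σ)))

end NumberFields

/-- The (stable) Faltings height `h_F(α)` of an algebraic number `α`: the height `h_F(E/L)` of a
semistable elliptic curve `E` over a number field `L` containing `α` with `j(E) = α`. -/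
def faltingsHeight (α : Qbar) : ℝ :=
  Classical.epsilon fun h : ℝ =>
    ∃ (L : IntermediateField ℚ Qbar) (_ : NumberField L) (E : WeierstrassCurve L)
      (_ : E.IsElliptic), IsSemistable E ∧ ((E.j : L) : Qbar) = α ∧ h = faltingsHeightCurve E

/-- The essential minimum of Faltings' height (an infimum of real numbers, taken in `[-∞, ∞]`). -/
def essentialMinimum : EReal :=
  sInf ((fun θ : ℝ => (θ : EReal)) '' {θ : ℝ | {α : Qbar | faltingsHeight α ≤ θ}.Infinite})

/-! ### The projective line over `ℤ` and the sections of the powers of `𝓛 = O(D_∞)` -/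

/-- Homogeneous coordinates on the projective line `F ∪ {∞}`: the point `ζ` is `[ζ : 1]` and the
point `∞` is `[1 : 0]`. -/
def coords {F : Type*} [Field F] : OnePoint F → Fin 2 → F
  | some ζ => ![ζ, 1]
  | none => ![1, 0]

/-- A nonzero global section over `ℙ¹_ℤ` of the power `𝓛^{⊗ deg}`: a nonzero homogeneous
polynomial of degree `deg` in the two homogeneous coordinates, with integral coefficients. -/
structure IntegralSection where
  /-- the power of `𝓛` -/
  deg : ℕ
  /-- the homogeneous form -/
  form : MvPolynomial (Fin 2) ℤ
  isHomogeneous : form.IsHomogeneous deg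
  ne_zero : form ≠ 0

namespace IntegralSection

/-- The section of `𝓛` corresponding to the modular form `Δ`: the second coordinate. -/
def delta : IntegralSection :=
  ⟨1, MvPolynomial.X 1, MvPolynomial.isHomogeneous_X ℤ 1, MvPolynomial.X_ne_zero 1⟩

/-- The points of `ℙ¹` over the algebraic numbers at which the section vanishes. -/
def support (s : IntegralSection) : Set (OnePoint Qbar) :=
  {x | MvPolynomial.aeval (coords x) s.form = 0}

/-- The canonical norm of a section at a finite place, at a `K`-point `x` of `ℙ¹`. -/
def canNorm {K : Type*} [Field K] [NumberField K] (s : IntegralSection) (v : FinitePlace K)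
    (x : OnePoint K) : ℝ :=
  v (MvPolynomial.aeval (coords x) s.form) / max (v (coords x 0)) (v (coords x 1)) ^ s.deg

/-- The Petersson norm at `τ` of the modular form of weight `12 deg` that corresponds to the
section, under `τ ↦ [c₄(τ)³ : Δ(τ)]`. -/
def petNormUpper (s : IntegralSection) (τ : ℍ) : ℝ :=
  (4 * Real.pi * τ.im) ^ (6 * s.deg) *
    ‖MvPolynomial.aeval ![(ModularForm.E₄ τ) ^ 3, ModularForm.discriminant τ] s.form‖

/-- The Petersson norm of a section at a point of `ℙ¹(ℂ)`. At `ζ = j(τ)` this is the norm at `τ`;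
at the point `∞`, where the metric is singular, it is the limit at the cusp, in `[0, ∞]`. -/
def petNorm (s : IntegralSection) : OnePoint ℂ → ℝ≥0∞
  | some ζ => ENNReal.ofReal (s.petNormUpper (Classical.epsilon fun τ : ℍ => jInv τ = ζ))
  | none => Filter.limsup (fun τ : ℍ => ENNReal.ofReal (s.petNormUpper τ)) atImInfty

end IntegralSection

/-! ### The Arakelov height -/

/-- The normalized sum of the local contributions `-log ‖s(ζ)‖_v` over all the places of `K`; an
archimedean place counts once for each embedding into `ℂ` that induces it. -/
def arakelovSum {K : Type*} [Field K] [NumberField K] (s : IntegralSection) (ζ : K) : ℝ :=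
  1 / (Module.finrank ℚ K : ℝ) *
    ((∑ᶠ v : FinitePlace K, -Real.log (s.canNorm v (ζ : OnePoint K))) +
      ∑ σ : K →+* ℂ, -Real.log (s.petNorm ((σ ζ : ℂ) : OnePoint ℂ)).toReal)

instance (α : Qbar) : NumberField (IntermediateField.adjoin ℚ {α}) := by
  have : FiniteDimensional ℚ (IntermediateField.adjoin ℚ {α}) :=
    IntermediateField.adjoin.finiteDimensional (Algebra.IsIntegral.isIntegral α)
  exact { to_charZero := inferInstance, to_finiteDimensional := inferInstance }

/-- The height of the point `[α : 1]` with respect to the metrized line bundle `𝓛`, computed over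
the number field `ℚ(α)` with the section `Δ`, which does not vanish at `[α : 1]`. (By the product
formula another number field or another section gives the same value.) -/
def arakelovHeight (α : Qbar) : ℝ :=
  arakelovSum IntegralSection.delta (IntermediateField.AdjoinSimple.gen ℚ α)

/-! ### Real global sections -/

/-- A real global section `s₁^{⊗ a₁} ⊗ ⋯ ⊗ s_ℓ^{⊗ a_ℓ}` with `a₁, …, a_ℓ > 0`, given by a
representation of it. -/
structure RealSection where
  /-- the number of factors -/
  len : ℕ
  /-- the factors -/
  factor : Fin len → IntegralSection
  /-- the exponents -/
  exponent : Fin len → ℝ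
  exponent_pos : ∀ k, 0 < exponent k

namespace RealSection

/-- The weight, normalized as for modular forms: the section `Δ` has weight `12`. -/
def weight (s : RealSection) : ℝ := 12 * ∑ k, s.exponent k * ((s.factor k).deg : ℝ)

/-- The support of the divisor. -/
def support (s : RealSection) : Set (OnePoint Qbar) := ⋃ k, (s.factor k).support

/-- The Petersson norm `∏ ‖s_k‖^{a_k}`, with values in `[0, ∞]`. -/
def petNorm (s : RealSection) (y : OnePoint ℂ) : ℝ≥0∞ :=
  ∏ k, ((s.factor k).petNorm y) ^ (s.exponent k)

/-- The Green function `g_s = - log ‖s‖`, with values in `[-∞, ∞]`. -/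
def green (s : RealSection) (y : OnePoint ℂ) : EReal := -ENNReal.log (s.petNorm y)

end RealSection

end FaltingsEssMin

end

/-!
For a semistable curve `E` over `K` the minimal discriminant measures the denominator of the
`j`-invariant: its norm is `∏ max(|j|_v, 1)` over the finite places. Hence `12 h_F` is the height
of `[j : 1]` for `𝓛`, computed with the section `Δ`, whose Petersson norm is `exp (-g_∞)`.
By the product formula a section of degree `n` computes `n` times that height. Its local
contributions at the finite places are nonnegative, because an integral form is bounded by `1` in
the canonical norm. So for a real section of weight one the height is at least the average of `g_s`
over the complex embeddings, which is at least its infimum. As `|div(s)|` is finite, the same bound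
holds for the essential minimum.

That a semistable curve with a given `j`-invariant exists at all follows by writing one curve in
Legendre form, which is semistable away from `2`, and in Deuring form, which is semistable away
from `3`; over a large enough field every algebraic number is the `j`-invariant of both, and the
two curves are isomorphic.
-/

noncomputable section

namespace FaltingsEssMin

section ModularForms

open Filter Topology ModularForm MatrixGroups

theorem tendsto_E_atImInfty {k : ℕ} (hk : 3 ≤ k) (hk_even : Even k) :
    Tendsto (fun τ : ℍ => E hk τ) atImInfty (𝓝 1) := by
  have valueAtInfty_E : valueAtInfty (E hk : ℍ → ℂ) = 1 := by
    rw [← EisensteinSeries.E_qExpansion_coeff_zero hk hk_even, qExpansion_coeff_zero one_pos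
      (ModularFormClass.analyticAt_cuspFunction_zero (E hk) one_pos one_mem_strictPeriods_SL)
      (SlashInvariantFormClass.periodic_comp_ofComplex (E hk) one_mem_strictPeriods_SL)]
  obtain ⟨c, hc, isBigO_exp⟩ := ModularFormClass.exp_decay_sub_atImInfty' (E hk)
  rw [valueAtInfty_E] at isBigO_exp
  have tendsto_exp : Tendsto (fun τ : ℍ => Real.exp (-c * τ.im)) atImInfty (𝓝 0) :=
    Real.tendsto_exp_atBot.comp
      ((tendsto_comap : Tendsto UpperHalfPlane.im atImInfty atTop).const_mul_atTop_of_neg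
        (neg_lt_zero.mpr hc))
  simpa using (isBigO_exp.trans_tendsto tendsto_exp).add_const 1

theorem exists_eq_const_mul_of_isBoundedAtImInfty_div {k : ℤ} (f g : ModularForm 𝒮ℒ k)
    (hf : ∀ τ, f τ ≠ 0) (hgf : IsBoundedAtImInfty (⇑g / ⇑f)) : ∃ c : ℂ, ∀ τ, g τ = c * f τ := by
  have slash_div (γ : SL(2, ℤ)) : (⇑g / ⇑f) ∣[(0 : ℤ)] γ = ⇑g / ⇑f := by
    have hγ : (γ : GL (Fin 2) ℝ) ∈ 𝒮ℒ := ⟨γ, rfl⟩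
    rw [← sub_self k, div_slash_SL2]
    simp_rw [SL_slash, SlashInvariantForm.slash_action_eqn _ _ hγ]
  let quotient : ModularForm 𝒮ℒ 0 :=
    { toFun := ⇑g / ⇑f
      slash_action_eq' := fun _ ⟨γ, hγ⟩ => hγ ▸ slash_div γ
      holo' := g.holo'.div f.holo' hf
      bdd_at_cusps' := fun {c} hc => by
        rw [Subgroup.IsArithmetic.isCusp_iff_isCusp_SL2Z] at hc
        rw [OnePoint.isBoundedAt_iff_forall_SL2Z hc]
        intro γ _
        rwa [slash_div γ] }
  obtain ⟨c, hc⟩ := ModularFormClass.levelOne_weight_zero_const quotient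
  exact ⟨c, fun τ => (div_eq_iff (hf τ)).mp (congrFun hc τ)⟩

theorem jInv_surjective : Function.Surjective jInv := by
  intro ζ
  by_contra! hζ
  let f : ModularForm 𝒮ℒ 12 :=
    ModularForm.mcast (by decide) (E₄.pow 3) - ζ • (CuspForm.discriminant : ModularForm 𝒮ℒ 12)
  have f_apply (τ : ℍ) : f τ = E₄ τ ^ 3 - ζ * discriminant τ := rfl
  have f_ne_zero (τ : ℍ) : f τ ≠ 0 := by
    rw [f_apply, sub_ne_zero]
    intro h
    exact hζ τ ((div_eq_iff (discriminant_ne_zero τ)).mpr h)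
  have tendsto_Δ : Tendsto discriminant atImInfty (𝓝 0) := discriminant_isZeroAtImInfty
  have tendsto_f : Tendsto f atImInfty (𝓝 1) := by
    have := ((tendsto_E_atImInfty (k := 4) (by norm_num) (by decide)).pow 3).sub
      (tendsto_Δ.const_mul ζ)
    rwa [one_pow, mul_zero, sub_zero] at this
  obtain ⟨c, hc⟩ := exists_eq_const_mul_of_isBoundedAtImInfty_div f
    (CuspForm.discriminant : ModularForm 𝒮ℒ 12) f_ne_zero
    ((tendsto_Δ.div tendsto_f one_ne_zero).isBigO_one ℝ)
  replace hc (τ : ℍ) : discriminant τ = c * f τ := hc τ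
  have c_eq_zero : c = 0 := by
    simpa using tendsto_nhds_unique (tendsto_f.const_mul c) (tendsto_Δ.congr hc)
  exact discriminant_ne_zero I (by rw [hc, c_eq_zero, zero_mul])

end ModularForms

section ComplexTori

open ModularForm EisensteinSeries

theorem periodPair_G (τ : ℍ) {k : ℕ} (hk : 3 ≤ k) :
    (periodPair τ).G k = 2 * riemannZeta k * E hk τ := by
  have G_eq_tsum_eisSummand : (periodPair τ).G k = ∑' v : Fin 2 → ℤ, eisSummand k v τ := by
    rw [PeriodPair.G, ← (periodPair τ).latticeEquivProd.symm.toEquiv.tsum_eq,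
      ← (Equiv.prodComm ℤ ℤ).tsum_eq, ← (finTwoArrowEquiv ℤ).tsum_eq]
    refine tsum_congr fun v => ?_
    change (((periodPair τ).latticeEquivProd.symm (v 1, v 0) : ℂ) ^ k)⁻¹ = _
    rw [(periodPair τ).latticeEquiv_symm_apply (v 1, v 0), eisSummand, zpow_neg, zpow_natCast]
    simp [periodPair, add_comm]
  rw [G_eq_tsum_eisSummand, tsum_eisSummand_eq_riemannZeta_mul_eisensteinSeries hk,
    show E hk τ = (1 / 2 : ℂ) • eisensteinSeriesSIF (N := 1) 0 k τ from rfl,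
    eisensteinSeriesSIF_apply 0 k τ, smul_eq_mul]
  ring

theorem riemannZeta_six : riemannZeta 6 = (Real.pi : ℂ) ^ 6 / 945 := by
  have bernoulli_six : bernoulli 6 = 1 / 42 := by
    have bernoulli'_five : bernoulli' 5 = 0 :=
      bernoulli'_eq_zero_of_odd (by decide) (by norm_num)
    rw [bernoulli_eq_bernoulli'_of_ne_one (by norm_num), bernoulli'_def]
    norm_num [Finset.sum_range_succ, Nat.choose, bernoulli'_five]
  have h := riemannZeta_two_mul_nat (k := 3) (by norm_num)
  norm_num [bernoulli_six, Nat.factorial] at h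
  rw [h]
  ring

theorem periodPair_g₂ (τ : ℍ) :
    (periodPair τ).g₂ = 4 / 3 * Real.pi ^ 4 * E₄ τ := by
  have hG := periodPair_G τ (k := 4) (by norm_num)
  norm_num [riemannZeta_four] at hG
  rw [PeriodPair.g₂, hG]
  ring

theorem periodPair_g₃ (τ : ℍ) :
    (periodPair τ).g₃ = 8 / 27 * Real.pi ^ 6 * E₆ τ := by
  have hG := periodPair_G τ (k := 6) (by norm_num)
  norm_num [riemannZeta_six] at hG
  rw [PeriodPair.g₃, hG]
  ring

theorem torusCurve_c₄ (τ : ℍ) : (torusCurve τ).c₄ = (2 * Real.pi) ^ 4 * E₄ τ := by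
  simp only [torusCurve, WeierstrassCurve.c₄, WeierstrassCurve.b₂, WeierstrassCurve.b₄,
    periodPair_g₂]
  ring

theorem torusCurve_Δ (τ : ℍ) : (torusCurve τ).Δ = (2 * Real.pi) ^ 12 * discriminant τ := by
  rw [discriminant_eq_E₄_cube_sub_E₆_sq]
  simp only [torusCurve, WeierstrassCurve.Δ, WeierstrassCurve.b₂, WeierstrassCurve.b₄,
    WeierstrassCurve.b₆, WeierstrassCurve.b₈, periodPair_g₂, periodPair_g₃]
  ring

theorem two_pi_ne_zero : (2 * Real.pi : ℂ) ≠ 0 := by exact_mod_cast Real.two_pi_pos.ne'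

instance isElliptic_torusCurve (τ : ℍ) : (torusCurve τ).IsElliptic := by
  rw [WeierstrassCurve.isElliptic_iff, torusCurve_Δ, isUnit_iff_ne_zero]
  exact mul_ne_zero (pow_ne_zero _ two_pi_ne_zero) (discriminant_ne_zero τ)

theorem j_eq_c₄_pow_div_Δ {F : Type*} [Field F] (E : WeierstrassCurve F) [E.IsElliptic] :
    E.j = E.c₄ ^ 3 / E.Δ := by
  rw [WeierstrassCurve.j, Units.val_inv_eq_inv_val, WeierstrassCurve.coe_Δ', inv_mul_eq_div]

theorem torusCurve_j (τ : ℍ) : (torusCurve τ).j = jInv τ := by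
  rw [j_eq_c₄_pow_div_Δ, torusCurve_c₄, torusCurve_Δ, jInv, mul_pow, ← pow_mul]
  exact mul_div_mul_left _ _ (pow_ne_zero _ two_pi_ne_zero)

theorem isUniformizedBy_iff (E : WeierstrassCurve ℂ) [E.IsElliptic] (τ : ℍ) :
    IsUniformizedBy E τ ↔ jInv τ = E.j := by
  rw [← torusCurve_j]
  constructor
  · rintro ⟨C, hC⟩
    simp_rw [← hC]
    exact WeierstrassCurve.variableChange_j _ _
  · intro h
    exact E.exists_variableChange_of_j_eq _ h.symm

/-- A chosen point of the upper half plane above `ζ`, the one at which `IntegralSection.petNorm`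
evaluates the Petersson norm. -/
def jPreimage (ζ : ℂ) : ℍ := Classical.epsilon fun τ : ℍ => jInv τ = ζ

theorem jInv_jPreimage (ζ : ℂ) : jInv (jPreimage ζ) = ζ :=
  Classical.epsilon_spec (jInv_surjective ζ)

theorem periodPoint_eq_jPreimage (E : WeierstrassCurve ℂ) [E.IsElliptic] :
    periodPoint E = jPreimage E.j := by
  simp_rw [periodPoint, jPreimage, isUniformizedBy_iff]

end ComplexTori

section SemistableReduction

open IsDiscreteValuationRing WeierstrassCurve

variable (R : Type*) [CommRing R] [IsDomain R] [IsDiscreteValuationRing R]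
variable {K : Type*} [Field K] [Algebra R K] [IsFractionRing R K]

/-- Good or multiplicative reduction at a discrete valuation ring `R`, read off from a minimal
Weierstrass equation over `R`; `IsSemistable` asks for it at every finite place. -/
def HasSemistableReduction (E : WeierstrassCurve K) : Prop :=
  (E.minimal R).HasGoodReduction R ∨ (E.minimal R).HasMultiplicativeReduction R

variable {R} in
theorem isIntegral_of_valuation_le_one {W : WeierstrassCurve K}
    (h₁ : (maximalIdeal R).valuation K W.a₁ ≤ 1) (h₂ : (maximalIdeal R).valuation K W.a₂ ≤ 1)
    (h₃ : (maximalIdeal R).valuation K W.a₃ ≤ 1) (h₄ : (maximalIdeal R).valuation K W.a₄ ≤ 1)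
    (h₆ : (maximalIdeal R).valuation K W.a₆ ≤ 1) : W.IsIntegral R :=
  isIntegral_of_exists_lift R (exists_lift_of_le_one h₁) (exists_lift_of_le_one h₂)
    (exists_lift_of_le_one h₃) (exists_lift_of_le_one h₄) (exists_lift_of_le_one h₆)

theorem valuation_Δ_le_one (W : WeierstrassCurve K) [W.IsIntegral R] :
    (maximalIdeal R).valuation K W.Δ ≤ 1 := by
  rw [← W.integralModel_Δ_eq R]
  exact (maximalIdeal R).valuation_le_one _

theorem valuation_c₄_le_one (W : WeierstrassCurve K) [W.IsIntegral R] :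
    (maximalIdeal R).valuation K W.c₄ ≤ 1 := by
  rw [← W.integralModel_c₄_eq R]
  exact (maximalIdeal R).valuation_le_one _

variable {R} in
theorem valuation_Δ_smul_le_of_isMinimal {W : WeierstrassCurve K} [hW : W.IsMinimal R]
    {C : VariableChange K} (hC : (C • W).IsIntegral R) :
    (maximalIdeal R).valuation K (C • W).Δ ≤ (maximalIdeal R).valuation K W.Δ := by
  have valuation_Δ_aux_le : (C • W).valuation_Δ_aux R ≤ W.valuation_Δ_aux R := by
    have le_of_le := hW.val_Δ_maximal.2 hC
    simp only [one_smul] at le_of_le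
    exact (le_total _ _).elim id le_of_le
  rwa [← Subtype.coe_le_coe, valuation_Δ_aux_eq_of_isIntegral,
    valuation_Δ_aux_eq_of_isIntegral] at valuation_Δ_aux_le

variable {R} in
theorem valuation_u_inv_le_one_of_isMinimal {W : WeierstrassCurve K} [W.IsElliptic]
    [W.IsMinimal R] {C : VariableChange K} (hC : (C • W).IsIntegral R) :
    (maximalIdeal R).valuation K (C.u⁻¹ : Kˣ) ≤ 1 := by
  have hΔ : 0 < (maximalIdeal R).valuation K W.Δ :=
    zero_lt_iff.mpr ((Valuation.ne_zero_iff _).mpr W.isUnit_Δ.ne_zero)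
  have h := valuation_Δ_smul_le_of_isMinimal hC
  rw [variableChange_Δ, map_mul, map_pow, mul_le_iff_le_one_left hΔ] at h
  exact (pow_le_one_iff (by norm_num)).mp h

instance isElliptic_minimal (E : WeierstrassCurve K) [E.IsElliptic] :
    (E.minimal R).IsElliptic := by
  unfold WeierstrassCurve.minimal
  infer_instance

theorem exists_smul_eq_minimal (E : WeierstrassCurve K) :
    ∃ C : VariableChange K, C • E = E.minimal R :=
  ⟨_, rfl⟩

theorem minimal_j (E : WeierstrassCurve K) [E.IsElliptic] : (E.minimal R).j = E.j := by
  unfold WeierstrassCurve.minimal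
  rw [variableChange_j]

theorem hasSemistableReduction_iff_minimal (E : WeierstrassCurve K) :
    HasSemistableReduction R E ↔ (maximalIdeal R).valuation K (E.minimal R).c₄ = 1 ∨
      (maximalIdeal R).valuation K (E.minimal R).Δ = 1 := by
  have hΔ := valuation_Δ_le_one R (E.minimal R)
  rw [HasSemistableReduction, hasGoodReduction_iff, hasMultiplicativeReduction_iff]
  have : (E.minimal R).IsMinimal R := inferInstance
  grind

theorem hasSemistableReduction_iff_exists (E : WeierstrassCurve K) [E.IsElliptic] :
    HasSemistableReduction R E ↔ ∃ C : VariableChange K, (C • E).IsIntegral R ∧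
      ((maximalIdeal R).valuation K (C • E).c₄ = 1 ∨
        (maximalIdeal R).valuation K (C • E).Δ = 1) := by
  rw [hasSemistableReduction_iff_minimal]
  obtain ⟨M, hM⟩ := exists_smul_eq_minimal R E
  constructor
  · intro h
    exact ⟨M, hM ▸ inferInstance, by rwa [hM]⟩
  · rintro ⟨C, hC, hunit⟩
    rw [show C • E = (C * M⁻¹) • E.minimal R by rw [← hM, mul_smul, inv_smul_smul]] at hC hunit
    have hu := valuation_u_inv_le_one_of_isMinimal hC
    rw [variableChange_c₄, variableChange_Δ, map_mul, map_mul, map_pow, map_pow] at hunit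
    exact hunit.imp
      (fun h => eq_one_of_one_le_mul_right (pow_le_one' hu 4) (valuation_c₄_le_one R _) h.ge)
      fun h => eq_one_of_one_le_mul_right (pow_le_one' hu 12) (valuation_Δ_le_one R _) h.ge

variable {R} in
theorem HasSemistableReduction.of_smul {E : WeierstrassCurve K} [E.IsElliptic]
    {C : VariableChange K} (h : HasSemistableReduction R (C • E)) : HasSemistableReduction R E := by
  rw [hasSemistableReduction_iff_exists] at h ⊢
  obtain ⟨D, hD⟩ := h
  exact ⟨D * C, by rwa [mul_smul]⟩

variable {R} in
theorem HasSemistableReduction.max_one_valuation_j {E : WeierstrassCurve K} [E.IsElliptic]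
    (h : HasSemistableReduction R E) :
    max 1 ((maximalIdeal R).valuation K E.j) =
      ((maximalIdeal R).valuation K (E.minimal R).Δ)⁻¹ := by
  have hc₄ := valuation_c₄_le_one R (E.minimal R)
  have hΔ := valuation_Δ_le_one R (E.minimal R)
  have hΔ_pos : 0 < (maximalIdeal R).valuation K (E.minimal R).Δ :=
    zero_lt_iff.mpr ((Valuation.ne_zero_iff _).mpr (E.minimal R).isUnit_Δ.ne_zero)
  rw [← minimal_j R E, j_eq_c₄_pow_div_Δ, map_div₀, map_pow]
  rcases (hasSemistableReduction_iff_minimal R E).mp h with h | h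
  · rw [h, one_pow, one_div]
    exact max_eq_right ((one_le_inv₀ hΔ_pos).mpr hΔ)
  · rw [h, div_one, inv_one]
    exact max_eq_left (pow_le_one' hc₄ 3)

end SemistableReduction

section NormalForms

open IsDiscreteValuationRing WeierstrassCurve

variable {K : Type*} [Field K]

/-- The Deuring normal form `Y² + a XY + Y = X³`, which has semistable reduction away from
residue characteristic `3`. -/
def deuringCurve (a : K) : WeierstrassCurve K := ⟨a, 0, 1, 0, 0⟩

/-- The Legendre normal form `Y² = X (X - 1) (X - m²)`, which has semistable reduction away from
residue characteristic `2`. The parameter is a square so that, when it is not integral, the scaling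
`X ↦ m² X`, `Y ↦ m³ Y` yields an integral equation. -/
def legendreCurve (m : K) : WeierstrassCurve K := ⟨0, -(1 + m ^ 2), 0, m ^ 2, 0⟩

theorem deuringCurve_Δ (a : K) : (deuringCurve a).Δ = a ^ 3 - 27 := by
  simp only [deuringCurve, Δ, b₂, b₄, b₆, b₈]
  ring

theorem deuringCurve_c₄ (a : K) : (deuringCurve a).c₄ = a * (a ^ 3 - 24) := by
  simp only [deuringCurve, c₄, b₂, b₄]
  ring

theorem legendreCurve_Δ (m : K) : (legendreCurve m).Δ = 16 * (m ^ 2 * (m ^ 2 - 1)) ^ 2 := by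
  simp only [legendreCurve, Δ, b₂, b₄, b₆, b₈]
  ring

theorem legendreCurve_c₄ (m : K) :
    (legendreCurve m).c₄ = 16 * (m ^ 2 * (m ^ 2 - 1) + 1) := by
  simp only [legendreCurve, c₄, b₂, b₄]
  ring

theorem smul_deuringCurve (a : Kˣ) :
    (⟨a, 0, 0, 0⟩ : VariableChange K) • deuringCurve (a : K) =
      ⟨1, 0, (a⁻¹ : K) ^ 3, 0, 0⟩ := by
  ext <;> simp [deuringCurve, variableChange_def]

theorem smul_legendreCurve (m : Kˣ) :
    (⟨m, 0, 0, 0⟩ : VariableChange K) • legendreCurve (m : K) =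
      ⟨0, -((m⁻¹ : K) ^ 2 + 1), 0, (m⁻¹ : K) ^ 2, 0⟩ := by
  ext <;> simp [legendreCurve, variableChange_def] <;> field_simp

variable (R : Type*) [CommRing R] [IsDomain R] [IsDiscreteValuationRing R] [Algebra R K]
  [IsFractionRing R K]

variable (K) in
theorem valuation_natCast_le_one (n : ℕ) : (maximalIdeal R).valuation K n ≤ 1 := by
  simpa using (maximalIdeal R).valuation_le_one (K := K) (n : R)

variable {R}

theorem hasSemistableReduction_deuringCurve_of_valuation_le_one {a : K}
    [(deuringCurve a).IsElliptic] (h3 : (maximalIdeal R).valuation K 3 = 1)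
    (ha : (maximalIdeal R).valuation K a ≤ 1) : HasSemistableReduction R (deuringCurve a) := by
  have isIntegral : (deuringCurve a).IsIntegral R := by
    apply isIntegral_of_valuation_le_one <;> simp [deuringCurve, ha]
  refine (hasSemistableReduction_iff_exists R _).mpr ⟨1, by rwa [one_smul], ?_⟩
  rw [one_smul, deuringCurve_c₄, deuringCurve_Δ]
  refine or_iff_not_imp_right.mpr fun hΔ => ?_
  replace hΔ : (maximalIdeal R).valuation K (a ^ 3 - 27) < 1 :=
    lt_of_le_of_ne (deuringCurve_Δ a ▸ valuation_Δ_le_one R (deuringCurve a)) hΔ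
  have valuation_a : (maximalIdeal R).valuation K a = 1 := by
    rw [← pow_eq_one_iff_of_nonneg zero_le three_ne_zero, ← map_pow,
      show a ^ 3 = (a ^ 3 - 27) + 3 ^ 3 by ring,
      Valuation.map_add_eq_of_lt_right] <;> simp [h3, hΔ]
  have valuation_sub : (maximalIdeal R).valuation K (a ^ 3 - 24) = 1 := by
    rw [show a ^ 3 - 24 = (a ^ 3 - 27) + 3 by ring,
      Valuation.map_add_eq_of_lt_right] <;> simp [h3, hΔ]
  rw [map_mul, valuation_a, valuation_sub, one_mul]

theorem hasSemistableReduction_deuringCurve_of_one_lt_valuation {a : K}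
    [(deuringCurve a).IsElliptic] (ha : 1 < (maximalIdeal R).valuation K a) :
    HasSemistableReduction R (deuringCurve a) := by
  lift a to Kˣ using ((Valuation.ne_zero_iff _).mp (zero_lt_one.trans ha).ne').isUnit
  have ha_inv : (maximalIdeal R).valuation K ((a : K)⁻¹ ^ 3) < 1 := by
    rw [map_pow, map_inv₀]
    exact pow_lt_one' (inv_lt_one_of_one_lt₀ ha) (by norm_num)
  refine (hasSemistableReduction_iff_exists R _).mpr ⟨⟨a, 0, 0, 0⟩, ?_, Or.inl ?_⟩
  · rw [smul_deuringCurve]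
    apply isIntegral_of_valuation_le_one <;> simp only [map_zero, map_one, zero_le, le_refl]
    exact ha_inv.le
  · rw [variableChange_c₄, deuringCurve_c₄, Units.val_inv_eq_inv_val,
      show (a : K)⁻¹ ^ 4 * (a * (a ^ 3 - 24)) = 1 - (24 : ℕ) * (a : K)⁻¹ ^ 3 by
        field_simp; norm_num,
      Valuation.map_one_sub_of_lt]
    rw [map_mul]
    exact mul_lt_one_of_nonneg_of_lt_one_right (valuation_natCast_le_one K R 24) zero_le ha_inv

theorem hasSemistableReduction_deuringCurve {a : K} [(deuringCurve a).IsElliptic]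
    (h3 : (maximalIdeal R).valuation K 3 = 1) : HasSemistableReduction R (deuringCurve a) :=
  (le_or_gt ((maximalIdeal R).valuation K a) 1).elim
    (hasSemistableReduction_deuringCurve_of_valuation_le_one h3)
    hasSemistableReduction_deuringCurve_of_one_lt_valuation

theorem valuation_sixteen_eq_one (h2 : (maximalIdeal R).valuation K 2 = 1) :
    (maximalIdeal R).valuation K 16 = 1 := by
  rw [show (16 : K) = 2 ^ 4 by norm_num, map_pow, h2, one_pow]

theorem hasSemistableReduction_legendreCurve_of_valuation_le_one {m : K}
    [(legendreCurve m).IsElliptic] (h2 : (maximalIdeal R).valuation K 2 = 1)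
    (hm : (maximalIdeal R).valuation K m ≤ 1) : HasSemistableReduction R (legendreCurve m) := by
  have hm_sq : (maximalIdeal R).valuation K (m ^ 2) ≤ 1 := by
    rw [map_pow]
    exact pow_le_one' hm 2
  have isIntegral : (legendreCurve m).IsIntegral R := by
    apply isIntegral_of_valuation_le_one <;>
      simp only [legendreCurve, map_zero, zero_le, hm_sq, Valuation.map_neg]
    exact Valuation.map_add_le _ (by simp) hm_sq
  refine (hasSemistableReduction_iff_exists R _).mpr ⟨1, by rwa [one_smul], ?_⟩
  rw [one_smul, legendreCurve_c₄, legendreCurve_Δ, map_mul, map_mul, map_pow,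
    valuation_sixteen_eq_one h2, one_mul, one_mul]
  have valuation_le_one : (maximalIdeal R).valuation K (m ^ 2 * (m ^ 2 - 1)) ≤ 1 := by
    rw [map_mul]
    exact mul_le_one' hm_sq (Valuation.map_sub_le _ hm_sq (by simp))
  rcases valuation_le_one.lt_or_eq with h | h
  · left
    rw [add_comm, Valuation.map_one_add_of_lt _ h]
  · right
    rw [h, one_pow]

theorem hasSemistableReduction_legendreCurve_of_one_lt_valuation {m : K}
    [(legendreCurve m).IsElliptic] (h2 : (maximalIdeal R).valuation K 2 = 1)
    (hm : 1 < (maximalIdeal R).valuation K m) : HasSemistableReduction R (legendreCurve m) := by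
  lift m to Kˣ using ((Valuation.ne_zero_iff _).mp (zero_lt_one.trans hm).ne').isUnit
  have hm_inv : (maximalIdeal R).valuation K ((m : K)⁻¹ ^ 2) < 1 := by
    rw [map_pow, map_inv₀]
    exact pow_lt_one' (inv_lt_one_of_one_lt₀ hm) (by norm_num)
  refine (hasSemistableReduction_iff_exists R _).mpr ⟨⟨m, 0, 0, 0⟩, ?_, Or.inl ?_⟩
  · rw [smul_legendreCurve]
    apply isIntegral_of_valuation_le_one <;>
      simp only [map_zero, zero_le, Valuation.map_neg, hm_inv.le]
    exact Valuation.map_add_le _ hm_inv.le (by simp)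
  · rw [variableChange_c₄, legendreCurve_c₄, Units.val_inv_eq_inv_val,
      show (m : K)⁻¹ ^ 4 * (16 * (m ^ 2 * (m ^ 2 - 1) + 1)) =
        16 * (1 + (m : K)⁻¹ ^ 2 * ((m : K)⁻¹ ^ 2 - 1)) by field_simp; ring,
      map_mul, valuation_sixteen_eq_one h2, one_mul, Valuation.map_one_add_of_lt]
    rw [map_mul]
    exact mul_lt_one_of_lt_of_le hm_inv (Valuation.map_sub_le _ hm_inv.le (by simp))

theorem hasSemistableReduction_legendreCurve {m : K} [(legendreCurve m).IsElliptic]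
    (h2 : (maximalIdeal R).valuation K 2 = 1) : HasSemistableReduction R (legendreCurve m) :=
  (le_or_gt ((maximalIdeal R).valuation K m) 1).elim
    (hasSemistableReduction_legendreCurve_of_valuation_le_one h2)
    (hasSemistableReduction_legendreCurve_of_one_lt_valuation h2)

variable (K R) in
theorem valuation_three_eq_one_or_valuation_two_eq_one :
    (maximalIdeal R).valuation K 3 = 1 ∨ (maximalIdeal R).valuation K 2 = 1 := by
  by_contra! h
  have h3 : (maximalIdeal R).valuation K 3 < 1 :=
    lt_of_le_of_ne (by exact_mod_cast valuation_natCast_le_one K R 3) h.1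
  have h2 : (maximalIdeal R).valuation K 2 < 1 :=
    lt_of_le_of_ne (by exact_mod_cast valuation_natCast_le_one K R 2) h.2
  have := Valuation.map_sub_lt _ h3 h2
  norm_num at this

variable (R) in
theorem hasSemistableReduction_of_smul_deuringCurve_eq {a m : K} [(deuringCurve a).IsElliptic]
    {C : VariableChange K} (hC : C • deuringCurve a = legendreCurve m) :
    HasSemistableReduction R (deuringCurve a) := by
  have : (legendreCurve m).IsElliptic := hC ▸ inferInstance
  rcases valuation_three_eq_one_or_valuation_two_eq_one K R with h3 | h2
  · exact hasSemistableReduction_deuringCurve h3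
  · exact .of_smul (hC ▸ hasSemistableReduction_legendreCurve h2)

end NormalForms

section FinitePlaces

variable {K : Type*} [Field K] [NumberField K] (v : HeightOneSpectrum (𝓞 K))

theorem localRing_valuation_isEquiv :
    ((IsDiscreteValuationRing.maximalIdeal (localRing v)).valuation K).IsEquiv
      (v.valuation K) := by
  refine Valuation.isEquiv_of_val_le_one fun {x} => ⟨fun h => ?_, fun h => ?_⟩
  · obtain ⟨a, rfl⟩ := IsDiscreteValuationRing.exists_lift_of_le_one h
    exact a.2
  · exact HeightOneSpectrum.valuation_le_one _ (⟨x, h⟩ : localRing v)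

theorem max_one_eq_inv_iff_of_isEquiv {F Γ₁ Γ₂ : Type*} [Field F]
    [LinearOrderedCommGroupWithZero Γ₁] [LinearOrderedCommGroupWithZero Γ₂]
    {v₁ : Valuation F Γ₁} {v₂ : Valuation F Γ₂} (h : v₁.IsEquiv v₂) (x y : F) :
    max 1 (v₁ x) = (v₁ y)⁻¹ ↔ max 1 (v₂ x) = (v₂ y)⁻¹ := by
  rw [← map_inv₀, ← map_inv₀, ← v₁.map_one, ← v₂.map_one, max_eq_iff, max_eq_iff, h.eq_iff,
    h.eq_iff, h.le_iff_le, h.le_iff_le]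

theorem pow_toNat_neg_log_eq_toNNReal_inv {e : NNReal} (he : e ≠ 0)
    {x : WithZero (Multiplicative ℤ)} (hx₀ : x ≠ 0) (hx₁ : x ≤ 1) :
    e ^ (-WithZero.log x).toNat = WithZeroMulInt.toNNReal he x⁻¹ := by
  obtain ⟨n, rfl⟩ : ∃ n : ℤ, x = WithZero.exp n :=
    ⟨WithZero.log x, (WithZero.exp_log hx₀).symm⟩
  have hn : n ≤ 0 := by simpa [← WithZero.exp_zero] using hx₁
  rw [map_inv₀, WithZeroMulInt.toNNReal_neg_apply _ hx₀, WithZero.toAdd_unzero_eq_log,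
    WithZero.log_exp, ← zpow_neg, ← zpow_natCast, Int.toNat_of_nonneg (by omega)]

theorem finitePlace_mk_eq_toNNReal (x : K) :
    FinitePlace.mk v x = WithZeroMulInt.toNNReal
      (NumberField.HeightOneSpectrum.absNorm_ne_zero v) (v.valuation K x) := by
  rw [FinitePlace.mk_apply, FinitePlace.norm_embedding']

theorem absNorm_pow_minDiscExponent {E : WeierstrassCurve K} [E.IsElliptic]
    (h : HasSemistableReduction (localRing v) E) :
    (Ideal.absNorm v.asIdeal : ℝ) ^ minDiscExponent E v = max (FinitePlace.mk v E.j) 1 := by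
  have valuation_j := (max_one_eq_inv_iff_of_isEquiv (localRing_valuation_isEquiv v) _ _).mp
    h.max_one_valuation_j
  have valuation_Δ_ne_zero : v.valuation K (E.minimal (localRing v)).Δ ≠ 0 :=
    (Valuation.ne_zero_iff _).mpr (E.minimal (localRing v)).isUnit_Δ.ne_zero
  have valuation_Δ_le : v.valuation K (E.minimal (localRing v)).Δ ≤ 1 :=
    (localRing_valuation_isEquiv v).le_one_iff_le_one.mp (valuation_Δ_le_one (localRing v) _)
  have toNNReal_mono := (WithZeroMulInt.toNNReal_strictMono
    (NumberField.HeightOneSpectrum.one_lt_absNorm_nnreal v)).monotone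
  rw [max_comm, finitePlace_mk_eq_toNNReal, ← NNReal.coe_one, ← NNReal.coe_max,
    ← map_one (WithZeroMulInt.toNNReal (NumberField.HeightOneSpectrum.absNorm_ne_zero v)),
    ← toNNReal_mono.map_max, valuation_j,
    ← pow_toNat_neg_log_eq_toNNReal_inv _ valuation_Δ_ne_zero valuation_Δ_le, minDiscExponent]
  simp

end FinitePlaces

section ExistsSemistable

open WeierstrassCurve Polynomial

theorem map_deuringCurve {K F : Type*} [Field K] [Field F] (φ : K →+* F) (a : K) :
    (deuringCurve a).map φ = deuringCurve (φ a) := by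
  simp [deuringCurve, WeierstrassCurve.map]

theorem map_legendreCurve {K F : Type*} [Field K] [Field F] (φ : K →+* F) (m : K) :
    (legendreCurve m).map φ = legendreCurve (φ m) := by
  simp [legendreCurve, WeierstrassCurve.map]

theorem isElliptic_of_map {K F : Type*} [Field K] [Field F] {φ : K →+* F}
    {E : WeierstrassCurve K} (h : (E.map φ).IsElliptic) : E.IsElliptic := by
  rw [isElliptic_iff, map_Δ, isUnit_map_iff] at h
  exact ⟨h⟩

theorem exists_variableChange_map_eq {K F : Type*} [Field K] [Field F] {φ : K →+* F}
    {C : VariableChange F} (hu : (C.u : F) ∈ Set.range φ) (hr : C.r ∈ Set.range φ)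
    (hs : C.s ∈ Set.range φ) (ht : C.t ∈ Set.range φ) :
    ∃ C' : VariableChange K, C'.map φ = C := by
  obtain ⟨u, hu⟩ := hu
  obtain ⟨r, hr⟩ := hr
  obtain ⟨s, hs⟩ := hs
  obtain ⟨t, ht⟩ := ht
  have u_ne_zero : u ≠ 0 := (map_ne_zero φ).mp (hu ▸ C.u.ne_zero)
  exact ⟨⟨Units.mk0 u u_ne_zero, r, s, t⟩, VariableChange.ext (Units.ext hu) hr hs ht⟩

theorem exists_deuringCurve_j_eq {F : Type*} [Field F] [IsAlgClosed F] (h3 : (3 : F) ≠ 0)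
    (α : F) : ∃ (a : F) (_ : (deuringCurve a).IsElliptic), (deuringCurve a).j = α := by
  have natDegree_eq : (X * (X - C 24) ^ 3 - C α * (X - C 27) : F[X]).natDegree = 4 := by
    compute_degree!
  obtain ⟨t, ht⟩ := IsAlgClosed.exists_root (X * (X - C 24) ^ 3 - C α * (X - C 27) : F[X])
    (degree_ne_of_natDegree_ne (natDegree_eq ▸ four_ne_zero))
  obtain ⟨a, rfl⟩ := IsAlgClosed.exists_pow_nat_eq t (n := 3) (by norm_num)
  replace ht : a ^ 3 * (a ^ 3 - 24) ^ 3 = α * (a ^ 3 - 27) := by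
    simpa [IsRoot.def, sub_eq_zero] using ht
  have hΔ : a ^ 3 - 27 ≠ 0 := fun h => pow_ne_zero 6 h3 (by
    rw [h, mul_zero, sub_eq_zero.mp h] at ht
    linear_combination ht)
  have isElliptic : (deuringCurve a).IsElliptic := ⟨deuringCurve_Δ a ▸ hΔ.isUnit⟩
  refine ⟨a, isElliptic, ?_⟩
  rw [j_eq_c₄_pow_div_Δ, deuringCurve_c₄, deuringCurve_Δ, div_eq_iff hΔ, mul_pow, ht]

theorem exists_legendreCurve_j_eq {F : Type*} [Field F] [IsAlgClosed F] (h2 : (2 : F) ≠ 0)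
    (α : F) : ∃ (m : F) (_ : (legendreCurve m).IsElliptic), (legendreCurve m).j = α := by
  have h256 : (256 : F) ≠ 0 := by
    rw [show (256 : F) = 2 ^ 8 by norm_num]
    exact pow_ne_zero 8 h2
  have h16 : (16 : F) ≠ 0 := fun h => h256 (by linear_combination 16 * h)
  have natDegree_cubic : (C 256 * (X + C 1) ^ 3 - C α * X ^ 2 : F[X]).natDegree = 3 := by
    compute_degree!
  obtain ⟨t, ht⟩ := IsAlgClosed.exists_root (C 256 * (X + C 1) ^ 3 - C α * X ^ 2 : F[X])
    (degree_ne_of_natDegree_ne (natDegree_cubic ▸ three_ne_zero))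
  have natDegree_quadratic : (X * (X - C 1) - C t : F[X]).natDegree = 2 := by
    compute_degree!
  obtain ⟨l, hl⟩ := IsAlgClosed.exists_root (X * (X - C 1) - C t : F[X])
    (degree_ne_of_natDegree_ne (natDegree_quadratic ▸ two_ne_zero))
  obtain ⟨m, rfl⟩ := IsAlgClosed.exists_pow_nat_eq l (n := 2) (by norm_num)
  obtain rfl : m ^ 2 * (m ^ 2 - 1) = t := by simpa [IsRoot.def, sub_eq_zero] using hl
  replace ht : 256 * (m ^ 2 * (m ^ 2 - 1) + 1) ^ 3 = α * (m ^ 2 * (m ^ 2 - 1)) ^ 2 := by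
    simpa [IsRoot.def, sub_eq_zero] using ht
  have hΔ : 16 * (m ^ 2 * (m ^ 2 - 1)) ^ 2 ≠ 0 :=
    mul_ne_zero h16 (pow_ne_zero 2 fun h => h256 (by simpa [h] using ht))
  have isElliptic : (legendreCurve m).IsElliptic := ⟨legendreCurve_Δ m ▸ hΔ.isUnit⟩
  refine ⟨m, isElliptic, ?_⟩
  rw [j_eq_c₄_pow_div_Δ, legendreCurve_c₄, legendreCurve_Δ, div_eq_iff hΔ]
  linear_combination 16 * ht

theorem exists_numberField_of_finite {S : Set Qbar} (hS : S.Finite) :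
    ∃ L : IntermediateField ℚ Qbar, NumberField L ∧ S ⊆ L := by
  have : Finite S := hS
  have : FiniteDimensional ℚ (IntermediateField.adjoin ℚ S) :=
    IntermediateField.finiteDimensional_adjoin fun x _ => Algebra.IsIntegral.isIntegral x
  exact ⟨IntermediateField.adjoin ℚ S,
    { to_charZero := inferInstance, to_finiteDimensional := this },
    IntermediateField.subset_adjoin ℚ S⟩

theorem exists_isSemistable_j_eq (α : Qbar) :
    ∃ (L : IntermediateField ℚ Qbar) (_ : NumberField L) (E : WeierstrassCurve L)
      (_ : E.IsElliptic), IsSemistable E ∧ ((E.j : L) : Qbar) = α := by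
  obtain ⟨a, isElliptic_deuringCurve, j_deuringCurve⟩ :=
    exists_deuringCurve_j_eq three_ne_zero α
  obtain ⟨m, isElliptic_legendreCurve, j_legendreCurve⟩ :=
    exists_legendreCurve_j_eq two_ne_zero α
  obtain ⟨C, hC⟩ := exists_variableChange_of_j_eq (deuringCurve a) (legendreCurve m)
    (j_deuringCurve.trans j_legendreCurve.symm)
  obtain ⟨L, hL, hS⟩ := exists_numberField_of_finite
    (Set.toFinite {a, m, (C.u : Qbar), C.r, C.s, C.t})
  let φ : L →+* Qbar := algebraMap L Qbar
  have subset_range : {a, m, (C.u : Qbar), C.r, C.s, C.t} ⊆ Set.range φ :=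
    fun x hx => ⟨⟨x, hS hx⟩, rfl⟩
  obtain ⟨a, rfl⟩ : a ∈ Set.range φ := subset_range (by simp)
  obtain ⟨m, rfl⟩ : m ∈ Set.range φ := subset_range (by simp)
  obtain ⟨C, rfl⟩ : ∃ C' : VariableChange L, C'.map φ = C := by
    apply exists_variableChange_map_eq <;> exact subset_range (by simp)
  simp_rw [← map_deuringCurve φ] at isElliptic_deuringCurve j_deuringCurve hC
  rw [← map_legendreCurve φ, map_variableChange] at hC
  have isElliptic := isElliptic_of_map isElliptic_deuringCurve
  refine ⟨L, hL, deuringCurve a, isElliptic, fun v => ?_, ?_⟩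
  · exact hasSemistableReduction_of_smul_deuringCurve_eq _ (map_injective φ.injective hC)
  · rw [← j_deuringCurve, map_j]
    rfl

end ExistsSemistable

section FinitePart

open Module

variable {K L : Type*} [Field K] [NumberField K] [Field L] [NumberField L] [Algebra K L]

/-- The finite part `∏_v max(|ζ|_v, 1)` of the multiplicative Weil height of `ζ`. When `ζ` is the
`j`-invariant of a semistable curve it is the norm of the minimal discriminant, and in general its
logarithm is the contribution of the finite places to the height of `[ζ : 1]` computed with the
section `Δ`. -/
def finiteHeight (ζ : K) : ℝ := ∏ᶠ v : FinitePlace K, max (v ζ) 1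

theorem hasFiniteMulSupport_max_one (ζ : K) :
    (fun v : FinitePlace K => max (v ζ) 1).HasFiniteMulSupport := by
  rcases eq_or_ne ζ 0 with rfl | hζ
  · simp [Function.HasFiniteMulSupport, Function.mulSupport]
  · exact (FinitePlace.hasFiniteMulSupport hζ).max Function.hasFiniteMulSupport_one

theorem finiteHeight_pos (ζ : K) : 0 < finiteHeight ζ :=
  one_pos.trans_le (one_le_finprod fun _ => le_max_right _ _)

theorem ciSup_fin_two {α : Type*} [ConditionallyCompleteLattice α] (f : Fin 2 → α) :
    ⨆ i, f i = f 0 ⊔ f 1 := by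
  rw [iSup, ← csSup_pair]
  congr
  ext
  simp [eq_comm]

theorem finiteHeight_div_mul_absNorm_span_pair (a : 𝓞 K) {b : 𝓞 K} (hb : b ≠ 0) :
    finiteHeight ((a : K) / b) * Ideal.absNorm (Ideal.span {a, b}) =
      Ideal.absNorm (Ideal.span {b}) := by
  have hbK : (b : K) ≠ 0 := by simpa using hb
  have norm_pair : Ideal.absNorm (Ideal.span {a, b}) * ∏ᶠ v : FinitePlace K, max (v a) (v b) =
      (1 : ℝ) := by
    have h := absNorm_mul_finprod_finitePlace_eq_one (x := ![a, b]) fun h => hb (congrFun h 1)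
    simpa [Set.pair_comm, ciSup_fin_two] using h
  have norm_single : Ideal.absNorm (Ideal.span {b}) * ∏ᶠ v : FinitePlace K, v b = (1 : ℝ) := by
    have h := absNorm_mul_finprod_finitePlace_eq_one
      (x := fun _ : Unit => b) fun h => hb (congrFun h ())
    simpa using h
  have finprod_max : ∏ᶠ v : FinitePlace K, max (v a) (v b) =
      finiteHeight ((a : K) / b) * ∏ᶠ v : FinitePlace K, v b := by
    rw [finiteHeight, ← finprod_mul_distrib (hasFiniteMulSupport_max_one _)
      (FinitePlace.hasFiniteMulSupport hbK)]
    refine finprod_congr fun v => ?_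
    have hvb : 0 < v b := FinitePlace.pos_iff.mpr hbK
    rw [map_div₀, max_mul_of_nonneg _ _ hvb.le, div_mul_cancel₀ _ hvb.ne', one_mul]
  apply mul_right_cancel₀ (right_ne_zero_of_mul_eq_one norm_single)
  rw [finprod_max] at norm_pair
  linear_combination norm_pair - norm_single

theorem absNorm_span_image_algebraMap (s : Set (𝓞 K)) :
    Ideal.absNorm (Ideal.span (algebraMap (𝓞 K) (𝓞 L) '' s)) =
      Ideal.absNorm (Ideal.span s) ^ finrank K L := by
  rw [← Ideal.map_span, Ideal.absNorm_algebraMap, IsFractionRing.finrank_eq (𝓞 K) K (𝓞 L) L]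

theorem finiteHeight_algebraMap (ζ : K) :
    finiteHeight (algebraMap K L ζ) = finiteHeight ζ ^ finrank K L := by
  obtain ⟨a, b, hb, rfl⟩ := IsFractionRing.div_surjective (𝓞 K) ζ
  have hb₀ : b ≠ 0 := nonZeroDivisors.ne_zero hb
  have over_K := finiteHeight_div_mul_absNorm_span_pair a hb₀
  have over_L := finiteHeight_div_mul_absNorm_span_pair (algebraMap (𝓞 K) (𝓞 L) a)
    (b := algebraMap (𝓞 K) (𝓞 L) b) (by simpa using hb₀)
  have absNorm_ne_zero : (Ideal.absNorm (Ideal.span {a, b}) : ℝ) ≠ 0 := by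
    refine right_ne_zero_of_mul (a := finiteHeight ((a : K) / b)) ?_
    simpa [over_K] using hb₀
  rw [← Set.image_pair, ← Set.image_singleton, absNorm_span_image_algebraMap,
    absNorm_span_image_algebraMap, Nat.cast_pow, Nat.cast_pow, ← over_K, mul_pow] at over_L
  rw [map_div₀]
  exact mul_right_cancel₀ (pow_ne_zero _ absNorm_ne_zero) over_L

theorem absNorm_minimalDiscriminant (E : WeierstrassCurve K) :
    (Ideal.absNorm (minimalDiscriminant E) : ℝ) =
      ∏ᶠ v : HeightOneSpectrum (𝓞 K), (Ideal.absNorm v.asIdeal : ℝ) ^ minDiscExponent E v := by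
  have map_finprod := ((Nat.castRingHom ℝ).toMonoidHom.comp
    Ideal.absNorm.toMonoidHom).map_finprod_of_preimage_one (by simp)
      fun v : HeightOneSpectrum (𝓞 K) => v.asIdeal ^ minDiscExponent E v
  simpa [minimalDiscriminant] using map_finprod

theorem IsSemistable.absNorm_minimalDiscriminant_eq {E : WeierstrassCurve K} [E.IsElliptic]
    (hE : IsSemistable E) : (Ideal.absNorm (minimalDiscriminant E) : ℝ) = finiteHeight E.j := by
  rw [absNorm_minimalDiscriminant, finiteHeight,
    ← finprod_comp_equiv FinitePlace.equivHeightOneSpectrum.symm]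
  exact finprod_congr fun v => absNorm_pow_minDiscExponent v (hE v)

end FinitePart

section Embeddings

open Module

theorem card_ringHom_comp_algebraMap_eq {K L F : Type*} [Field K] [Field L] [Field F]
    [Algebra K L] [FiniteDimensional K L] [Algebra.IsSeparable K L] [IsAlgClosed F]
    (τ : K →+* F) :
    Nat.card {σ : L →+* F // σ.comp (algebraMap K L) = τ} = finrank K L := by
  let _ : Algebra K F := τ.toAlgebra
  rw [← AlgHom.card K L F, ← Nat.card_eq_fintype_card]
  exact Nat.card_congr
    { toFun := fun σ => { σ.1 with commutes' := RingHom.congr_fun σ.2 }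
      invFun := fun σ => ⟨σ.toRingHom, RingHom.ext σ.commutes⟩
      left_inv := fun _ => rfl
      right_inv := fun _ => rfl }

variable {K L : Type*} [Field K] [NumberField K] [Field L] [NumberField L] [Algebra K L]

theorem sum_embeddings_comp_algebraMap {M : Type*} [AddCommMonoid M] (f : (K →+* ℂ) → M) :
    ∑ σ : L →+* ℂ, f (σ.comp (algebraMap K L)) = finrank K L • ∑ τ : K →+* ℂ, f τ := by
  classical
  rw [← Finset.sum_fiberwise Finset.univ (fun σ : L →+* ℂ => σ.comp (algebraMap K L)),
    Finset.smul_sum]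
  refine Finset.sum_congr rfl fun τ _ => ?_
  rw [Finset.sum_congr rfl (g := fun _ => f τ) fun σ hσ => by rw [(Finset.mem_filter.mp hσ).2],
    Finset.sum_const, ← card_ringHom_comp_algebraMap_eq τ, Nat.card_eq_fintype_card,
    Fintype.card_subtype]

theorem prod_norm_embeddings_eq_abs_norm (x : K) :
    ∏ σ : K →+* ℂ, ‖σ x‖ = |(Algebra.norm ℚ x : ℝ)| := by
  have norm_eq_prod := congr_arg (‖·‖) (Algebra.norm_eq_prod_embeddings ℚ ℂ x)
  rw [norm_prod, ← Fintype.prod_equiv (RingHom.equivRatAlgHom K ℂ) (fun σ => ‖σ x‖)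
    (fun φ => ‖φ x‖) fun _ => by simp [RingHom.equivRatAlgHom_apply]] at norm_eq_prod
  rw [← norm_eq_prod, eq_ratCast, ← Real.norm_eq_abs, ← Complex.norm_real, Complex.ofReal_ratCast]

theorem finprod_finitePlace_mul_prod_embeddings {x : K} (hx : x ≠ 0) :
    (∏ᶠ v : FinitePlace K, v x) * ∏ σ : K →+* ℂ, ‖σ x‖ = 1 := by
  rw [FinitePlace.prod_eq_inv_abs_norm hx, prod_norm_embeddings_eq_abs_norm]
  simp [hx]

end Embeddings

section HomogeneousForms

open MvPolynomial

theorem aeval_mul_of_isHomogeneous {ι R A : Type*} [CommSemiring R] [CommSemiring A] [Algebra R A]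
    {p : MvPolynomial ι R} {n : ℕ} (hp : p.IsHomogeneous n) (c : A) (x : ι → A) :
    aeval (fun i => c * x i) p = c ^ n * aeval x p := by
  simp only [aeval_def, eval₂_eq, Finset.mul_sum]
  refine Finset.sum_congr rfl fun d hd => ?_
  simp only [mul_pow, Finset.prod_mul_distrib, Finset.prod_pow_eq_pow_sum,
    ← hp.degree_eq_sum_deg_support hd]
  ring

theorem map_aeval_vec_one {A B : Type*} [CommRing A] [CommRing B] (φ : A →+* B) (ζ : A)
    (p : MvPolynomial (Fin 2) ℤ) : φ (aeval ![ζ, 1] p) = aeval ![φ ζ, 1] p := by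
  have comp_vec : (fun i => φ.toIntAlgHom (![ζ, 1] i)) = ![φ ζ, 1] :=
    funext (Fin.forall_fin_two.mpr ⟨rfl, map_one φ⟩)
  rw [← comp_vec, ← comp_aeval_apply]
  rfl

theorem finite_setOf_aeval_vec_one_eq_zero {R A : Type*} [CommRing R] [IsDomain R]
    [CommRing A] [IsDomain A] [Algebra R A] [Module.IsTorsionFree R A]
    {p : MvPolynomial (Fin 2) R} {n : ℕ} (hp : p.IsHomogeneous n) (hp₀ : p ≠ 0) :
    {ζ : A | aeval ![ζ, 1] p = 0}.Finite := by
  have dehomogenize_ne_zero : aeval ![(Polynomial.X : Polynomial R), 1] p ≠ 0 := fun h =>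
    hp₀ ((Polynomial.homogenize_eq_of_isHomogeneous hp h).symm.trans (by simp))
  refine (Polynomial.rootSet_finite (aeval ![(Polynomial.X : Polynomial R), 1] p) A).subset
    fun ζ hζ => ?_
  have comp_vec : (fun i => Polynomial.aeval ζ (![(Polynomial.X : Polynomial R), 1] i)) =
      ![ζ, 1] := funext (Fin.forall_fin_two.mpr ⟨Polynomial.aeval_X ζ, map_one _⟩)
  rw [Polynomial.mem_rootSet]
  exact ⟨dehomogenize_ne_zero, by rwa [comp_aeval_apply, comp_vec]⟩

theorem apply_aeval_le_pow_of_isHomogeneous {F ι : Type*} [Field F] [Finite ι]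
    {v : AbsoluteValue F ℝ} (hv : IsNonarchimedean v) {p : MvPolynomial ι ℤ} {n : ℕ}
    (hp : p.IsHomogeneous n) (x : ι → F) : v (aeval x p) ≤ (⨆ i, v (x i)) ^ n := by
  have coeff_le_one : ⨆ d : (map (algebraMap ℤ F) p).support,
      v (coeff d (map (algebraMap ℤ F) p)) ≤ 1 := by
    refine Real.iSup_le (fun d => ?_) zero_le_one
    rw [coeff_map]
    exact hv.apply_intCast_le_one
  rw [aeval_def, ← eval_map]
  exact (hv.eval_mvPolynomial_le (hp.map _) x).trans (mul_le_of_le_one_left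
    (pow_nonneg (Real.iSup_nonneg fun i => v.nonneg (x i)) n) coeff_le_one)

end HomogeneousForms

namespace IntegralSection

open MvPolynomial

theorem exp_neg_gInf (τ : ℍ) :
    Real.exp (-gInf τ) = (4 * Real.pi * τ.im) ^ 6 * ‖ModularForm.discriminant τ‖ := by
  have := τ.im_pos
  have := norm_pos_iff.mpr (ModularForm.discriminant_ne_zero τ)
  rw [gInf, neg_neg, Real.exp_log (by positivity)]

theorem petNormUpper_eq (s : IntegralSection) (τ : ℍ) :
    s.petNormUpper τ = Real.exp (-gInf τ) ^ s.deg * ‖aeval ![jInv τ, 1] s.form‖ := by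
  have coords_eq : ![(ModularForm.E₄ τ) ^ 3, ModularForm.discriminant τ] =
      fun i => ModularForm.discriminant τ * ![jInv τ, 1] i := by
    refine funext (Fin.forall_fin_two.mpr ⟨?_, (mul_one _).symm⟩)
    exact (mul_div_cancel₀ _ (ModularForm.discriminant_ne_zero τ)).symm
  rw [petNormUpper, coords_eq, aeval_mul_of_isHomogeneous s.isHomogeneous, exp_neg_gInf, norm_mul,
    norm_pow, pow_mul, mul_pow (_ ^ 6), ← mul_assoc]

theorem toReal_petNorm_coe (s : IntegralSection) (ζ : ℂ) :
    (s.petNorm ζ).toReal = Real.exp (-gInf (jPreimage ζ)) ^ s.deg * ‖aeval ![ζ, 1] s.form‖ := by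
  have petNorm_eq : s.petNorm ζ = ENNReal.ofReal (s.petNormUpper (jPreimage ζ)) := rfl
  rw [petNorm_eq, petNormUpper_eq, jInv_jPreimage, ENNReal.toReal_ofReal (by positivity)]

theorem petNorm_coe_ne_top (s : IntegralSection) (ζ : ℂ) : s.petNorm ζ ≠ ⊤ :=
  ENNReal.ofReal_ne_top

theorem petNorm_coe_ne_zero {s : IntegralSection} {ζ : ℂ} (h : aeval ![ζ, 1] s.form ≠ 0) :
    s.petNorm ζ ≠ 0 := by
  have : 0 < (s.petNorm ζ).toReal := by
    rw [toReal_petNorm_coe]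
    have := norm_pos_iff.mpr h
    positivity
  exact (ENNReal.toReal_pos_iff.mp this).1.ne'

theorem neg_log_petNorm_coe {s : IntegralSection} {ζ : ℂ} (h : aeval ![ζ, 1] s.form ≠ 0) :
    -Real.log (s.petNorm ζ).toReal =
      s.deg * gInf (jPreimage ζ) - Real.log ‖aeval ![ζ, 1] s.form‖ := by
  rw [toReal_petNorm_coe, Real.log_mul (pow_pos (Real.exp_pos _) _).ne' (norm_ne_zero_iff.mpr h),
    Real.log_pow, Real.log_exp]
  ring

variable {K : Type*} [Field K] [NumberField K]

theorem canNorm_coe (s : IntegralSection) (v : FinitePlace K) (ζ : K) :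
    s.canNorm v ζ = v (aeval ![ζ, 1] s.form) / max (v ζ) 1 ^ s.deg := by
  rw [← map_one v]
  rfl

theorem canNorm_coe_le_one (s : IntegralSection) (v : FinitePlace K) (ζ : K) :
    s.canNorm v ζ ≤ 1 := by
  rw [canNorm_coe, div_le_one (by positivity)]
  have := apply_aeval_le_pow_of_isHomogeneous (v := v.val) v.add_le s.isHomogeneous ![ζ, 1]
  rw [ciSup_fin_two] at this
  exact map_one v ▸ this

theorem neg_log_canNorm_coe_nonneg (s : IntegralSection) (v : FinitePlace K) (ζ : K) :
    0 ≤ -Real.log (s.canNorm v ζ) :=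
  neg_nonneg.mpr (Real.log_nonpos (by rw [canNorm_coe]; positivity) (s.canNorm_coe_le_one v ζ))

theorem finsum_neg_log_canNorm_coe {s : IntegralSection} {ζ : K}
    (h : aeval ![ζ, 1] s.form ≠ 0) :
    ∑ᶠ v : FinitePlace K, -Real.log (s.canNorm v ζ) =
      s.deg * Real.log (finiteHeight ζ) -
        Real.log (∏ᶠ v : FinitePlace K, v (aeval ![ζ, 1] s.form)) := by
  have pos (v : FinitePlace K) : 0 < v (aeval ![ζ, 1] s.form) := FinitePlace.pos_iff.mpr h
  have finprod_ne_zero := left_ne_zero_of_mul_eq_one (finprod_finitePlace_mul_prod_embeddings h)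
  have finite_mulSupport_pow :
      Function.HasFiniteMulSupport fun v : FinitePlace K => max (v ζ) 1 ^ s.deg :=
    (hasFiniteMulSupport_max_one ζ).pow s.deg
  have finprod_eq : ∏ᶠ v : FinitePlace K, s.canNorm v ζ =
      (∏ᶠ v : FinitePlace K, v (aeval ![ζ, 1] s.form)) / finiteHeight ζ ^ s.deg := by
    simp_rw [canNorm_coe]
    rw [finprod_div_distrib (FinitePlace.hasFiniteMulSupport h) finite_mulSupport_pow,
      finiteHeight, finprod_pow (hasFiniteMulSupport_max_one ζ)]
  rw [finsum_neg_distrib, ← Real.log_finprod fun v => by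
      rw [canNorm_coe]; exact div_pos (pos v) (by positivity),
    finprod_eq, Real.log_div finprod_ne_zero (pow_pos (finiteHeight_pos ζ) _).ne', Real.log_pow]
  ring

end IntegralSection

section ArakelovHeight

open Module MvPolynomial

variable {K : Type*} [Field K] [NumberField K]

theorem arakelovSum_eq {s : IntegralSection} {ζ : K} (h : aeval ![ζ, 1] s.form ≠ 0) :
    arakelovSum s ζ = 1 / (finrank ℚ K : ℝ) *
      (s.deg * (Real.log (finiteHeight ζ) + ∑ σ : K →+* ℂ, gInf (jPreimage (σ ζ)))) := by
  have aeval_ne_zero (σ : K →+* ℂ) : aeval ![σ ζ, 1] s.form ≠ 0 := by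
    rwa [← map_aeval_vec_one, map_ne_zero]
  have product_formula := congrArg Real.log (finprod_finitePlace_mul_prod_embeddings h)
  rw [Real.log_mul
      (left_ne_zero_of_mul_eq_one (finprod_finitePlace_mul_prod_embeddings h))
      (right_ne_zero_of_mul_eq_one (finprod_finitePlace_mul_prod_embeddings h)),
    Real.log_prod fun σ _ => norm_ne_zero_iff.mpr ((map_ne_zero σ).mpr h),
    Real.log_one] at product_formula
  rw [arakelovSum, IntegralSection.finsum_neg_log_canNorm_coe h,
    Finset.sum_congr rfl fun σ _ => IntegralSection.neg_log_petNorm_coe (aeval_ne_zero σ),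
    Finset.sum_sub_distrib, ← Finset.mul_sum]
  simp_rw [← map_aeval_vec_one]
  linear_combination -(1 / (finrank ℚ K : ℝ)) * product_formula

theorem arakelovSum_delta (ζ : K) :
    arakelovSum IntegralSection.delta ζ = 1 / (finrank ℚ K : ℝ) *
      (Real.log (finiteHeight ζ) + ∑ σ : K →+* ℂ, gInf (jPreimage (σ ζ))) := by
  rw [arakelovSum_eq (by simp [IntegralSection.delta])]
  simp [IntegralSection.delta]

theorem arakelovSum_eq_deg_mul_arakelovSum_delta {s : IntegralSection} {ζ : K}
    (h : aeval ![ζ, 1] s.form ≠ 0) :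
    arakelovSum s ζ = s.deg * arakelovSum IntegralSection.delta ζ := by
  rw [arakelovSum_eq h, arakelovSum_delta, mul_left_comm]

theorem sum_neg_log_petNorm_le_arakelovSum (s : IntegralSection) (ζ : K) :
    1 / (finrank ℚ K : ℝ) * ∑ σ : K →+* ℂ, -Real.log (s.petNorm (σ ζ)).toReal ≤
      arakelovSum s ζ := by
  rw [arakelovSum]
  gcongr
  exact le_add_of_nonneg_left (finsum_nonneg fun v => s.neg_log_canNorm_coe_nonneg v ζ)

theorem arakelovSum_delta_algebraMap {L : Type*} [Field L] [NumberField L] [Algebra K L] (ζ : K) :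
    arakelovSum IntegralSection.delta (algebraMap K L ζ) =
      arakelovSum IntegralSection.delta ζ := by
  have finrank_KL_ne_zero : (finrank K L : ℝ) ≠ 0 := by exact_mod_cast finrank_pos.ne'
  rw [arakelovSum_delta, arakelovSum_delta, finiteHeight_algebraMap, Real.log_pow,
    ← finrank_mul_finrank ℚ K L, Nat.cast_mul]
  have sum_gInf := sum_embeddings_comp_algebraMap (L := L) fun τ : K →+* ℂ =>
    gInf (jPreimage (τ ζ))
  simp only [RingHom.comp_apply, nsmul_eq_mul] at sum_gInf
  rw [sum_gInf]
  field_simp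

theorem IsSemistable.faltingsHeightCurve_eq {E : WeierstrassCurve K} [E.IsElliptic]
    (hE : IsSemistable E) :
    faltingsHeightCurve E = 1 / 12 * arakelovSum IntegralSection.delta E.j := by
  rw [faltingsHeightCurve, hE.absNorm_minimalDiscriminant_eq, arakelovSum_delta]
  simp_rw [periodPoint_eq_jPreimage, WeierstrassCurve.map_j]
  ring

theorem arakelovHeight_eq_arakelovSum {L : IntermediateField ℚ Qbar} [NumberField L] (ζ : L) :
    arakelovHeight ζ = arakelovSum IntegralSection.delta ζ := by
  let _ : Algebra (IntermediateField.adjoin ℚ {(ζ : Qbar)}) L :=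
    (IntermediateField.inclusion
      (IntermediateField.adjoin_simple_le_iff.mpr ζ.2)).toRingHom.toAlgebra
  exact (arakelovSum_delta_algebraMap (L := L)
    (IntermediateField.AdjoinSimple.gen ℚ (ζ : Qbar))).symm

theorem faltingsHeight_eq (x : Qbar) : faltingsHeight x = 1 / 12 * arakelovHeight x := by
  have exists_height : ∃ (h : ℝ) (L : IntermediateField ℚ Qbar) (_ : NumberField L)
      (E : WeierstrassCurve L) (_ : E.IsElliptic), IsSemistable E ∧ ((E.j : L) : Qbar) = x ∧
        h = faltingsHeightCurve E := by
    obtain ⟨L, numberField, E, isElliptic, isSemistable, j_eq⟩ := exists_isSemistable_j_eq x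
    exact ⟨_, L, numberField, E, isElliptic, isSemistable, j_eq, rfl⟩
  obtain ⟨L, _, E, _, isSemistable, rfl, (height_eq : faltingsHeight _ = _)⟩ :=
    Classical.epsilon_spec exists_height
  rw [height_eq, isSemistable.faltingsHeightCurve_eq, arakelovHeight_eq_arakelovSum]

end ArakelovHeight

section RealSections

open Module MvPolynomial

theorem log_prod_rpow_eq_sum {ι : Type*} (t : Finset ι) {x : ι → ℝ≥0∞}
    (a : ι → ℝ) (h₀ : ∀ k ∈ t, x k ≠ 0) (h_top : ∀ k ∈ t, x k ≠ ⊤) :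
    ENNReal.log (∏ k ∈ t, x k ^ a k) = ((∑ k ∈ t, a k * Real.log (x k).toReal : ℝ) : EReal) := by
  have toReal_pos (k) (hk : k ∈ t) : 0 < (x k).toReal := ENNReal.toReal_pos (h₀ k hk) (h_top k hk)
  have rpow_ne_zero (k) (hk : k ∈ t) : (x k).toReal ^ a k ≠ 0 :=
    (Real.rpow_pos_of_pos (toReal_pos k hk) _).ne'
  rw [ENNReal.log_pos_real
    (Finset.prod_ne_zero_iff.mpr fun k hk => (ENNReal.rpow_pos (pos_iff_ne_zero.mpr (h₀ k hk))
      (h_top k hk)).ne')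
    (ENNReal.prod_ne_top fun k hk => ENNReal.rpow_ne_top_of_ne_zero (h₀ k hk) (h_top k hk)),
    ENNReal.toReal_prod]
  simp_rw [← ENNReal.toReal_rpow]
  rw [Real.log_prod rpow_ne_zero]
  exact congrArg _ (Finset.sum_congr rfl fun k hk => Real.log_rpow (toReal_pos k hk) _)

namespace RealSection

variable {s : RealSection}

theorem green_coe {ζ : ℂ} (h : ∀ k, aeval ![ζ, 1] (s.factor k).form ≠ 0) :
    s.green ζ =
      ((∑ k, s.exponent k * -Real.log ((s.factor k).petNorm ζ).toReal : ℝ) : EReal) := by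
  rw [green, petNorm, log_prod_rpow_eq_sum _ _
    (fun k _ => IntegralSection.petNorm_coe_ne_zero (h k))
    (fun k _ => (s.factor k).petNorm_coe_ne_top ζ), ← EReal.coe_neg]
  simp only [mul_neg, Finset.sum_neg_distrib]

theorem sum_neg_log_petNorm_le_weight_mul_arakelovSum {K : Type*} [Field K] [NumberField K] {ζ : K}
    (h : ∀ k, aeval ![ζ, 1] (s.factor k).form ≠ 0) :
    1 / (finrank ℚ K : ℝ) *
        ∑ σ : K →+* ℂ, ∑ k, s.exponent k * -Real.log ((s.factor k).petNorm (σ ζ)).toReal ≤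
      s.weight / 12 * arakelovSum IntegralSection.delta ζ := by
  rw [Finset.sum_comm, Finset.mul_sum, weight, mul_div_cancel_left₀ _ (by norm_num),
    Finset.sum_mul]
  refine Finset.sum_le_sum fun k _ => ?_
  rw [← Finset.mul_sum, mul_left_comm, mul_assoc, ← arakelovSum_eq_deg_mul_arakelovSum_delta (h k)]
  exact mul_le_mul_of_nonneg_left (sum_neg_log_petNorm_le_arakelovSum _ ζ) (s.exponent_pos k).le

theorem iInf_green_le_weight_mul_arakelovSum {K : Type*} [Field K] [NumberField K] {ζ : K}
    (h : ∀ k, aeval ![ζ, 1] (s.factor k).form ≠ 0) :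
    ⨅ y, s.green y ≤ ((s.weight / 12 * arakelovSum IntegralSection.delta ζ : ℝ) : EReal) := by
  have finrank_pos : (0 : ℝ) < finrank ℚ K := by exact_mod_cast finrank_pos
  have sum_le := sum_neg_log_petNorm_le_weight_mul_arakelovSum h
  rw [one_div, inv_mul_le_iff₀ finrank_pos, ← Embeddings.card K ℂ, ← nsmul_eq_mul,
    ← Finset.card_univ] at sum_le
  obtain ⟨σ, -, hσ⟩ := Finset.exists_le_of_sum_le Finset.univ_nonempty
    (sum_le.trans_eq (Finset.sum_const _).symm)
  refine (iInf_le _ (σ ζ : OnePoint ℂ)).trans ?_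
  rw [green_coe fun k => by rw [← map_aeval_vec_one, map_ne_zero]; exact h k]
  exact_mod_cast hσ

theorem iInf_green_le_weight_mul_arakelovHeight {x : Qbar} (hx : (x : OnePoint Qbar) ∉ s.support) :
    ⨅ y, s.green y ≤ ((s.weight / 12 * arakelovHeight x : ℝ) : EReal) := by
  refine iInf_green_le_weight_mul_arakelovSum fun k h => hx (Set.mem_iUnion.mpr ⟨k, ?_⟩)
  have := map_aeval_vec_one (algebraMap _ Qbar) (IntermediateField.AdjoinSimple.gen ℚ x)
    (s.factor k).form
  rw [h, map_zero] at this
  exact this.symm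

theorem iInf_green_le_faltingsHeight (hs : s.weight = 1) {x : Qbar}
    (hx : (x : OnePoint Qbar) ∉ s.support) : ⨅ y, s.green y ≤ (faltingsHeight x : EReal) := by
  rw [faltingsHeight_eq, ← hs]
  exact iInf_green_le_weight_mul_arakelovHeight hx

theorem iInf_green_eq_neg_log_iSup_petNorm (s : RealSection) :
    ⨅ y, s.green y = -ENNReal.log (⨆ y, s.petNorm y) := by
  have log_iSup : ENNReal.log (⨆ y, s.petNorm y) = ⨆ y, ENNReal.log (s.petNorm y) :=
    ENNReal.logOrderIso.map_iSup _
  rw [log_iSup]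
  exact (EReal.negOrderIso.map_iSup fun y => ENNReal.log (s.petNorm y)).symm

theorem finite_setOf_coe_mem_support (s : RealSection) :
    {x : Qbar | (x : OnePoint Qbar) ∈ s.support}.Finite := by
  have finite_zeros (k) : {x : Qbar | (x : OnePoint Qbar) ∈ (s.factor k).support}.Finite :=
    finite_setOf_aeval_vec_one_eq_zero (s.factor k).isHomogeneous (s.factor k).ne_zero
  simpa only [support, Set.mem_iUnion, Set.ofPred_exists] using Set.finite_iUnion finite_zeros

end RealSection

theorem le_essentialMinimum_of_finite {S : Set Qbar} (hS : S.Finite) {b : EReal}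
    (h : ∀ x ∉ S, b ≤ faltingsHeight x) : b ≤ essentialMinimum := by
  refine le_sInf ?_
  rintro _ ⟨θ, hθ, rfl⟩
  obtain ⟨x, hxθ, hxS⟩ := (Set.Infinite.sdiff hθ hS).nonempty
  exact (h x hxS).trans (EReal.coe_le_coe_iff.mpr hxθ)

end RealSections

end FaltingsEssMin

end

theorem mainTheorem10 (s : FaltingsEssMin.RealSection) (hs : s.weight = 1) :
    (∀ x : FaltingsEssMin.Qbar, (x : OnePoint FaltingsEssMin.Qbar) ∉ s.support →
      FaltingsEssMin.faltingsHeight x = 1 / 12 * FaltingsEssMin.arakelovHeight x ∧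
        (⨅ y : OnePoint ℂ, s.green y) ≤ (FaltingsEssMin.faltingsHeight x : EReal)) ∧
      (⨅ y : OnePoint ℂ, s.green y) = -ENNReal.log (⨆ y : OnePoint ℂ, s.petNorm y) ∧
      (⨅ y : OnePoint ℂ, s.green y) ≤ FaltingsEssMin.essentialMinimum :=
  ⟨fun x hx => ⟨FaltingsEssMin.faltingsHeight_eq x,
      FaltingsEssMin.RealSection.iInf_green_le_faltingsHeight hs hx⟩,
    s.iInf_green_eq_neg_log_iSup_petNorm,
    FaltingsEssMin.le_essentialMinimum_of_finite s.finite_setOf_coe_mem_support fun _ hx =>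
      FaltingsEssMin.RealSection.iInf_green_le_faltingsHeight hs hx⟩
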